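/- Let $k$ be a field of any characteristic, and let $F=\{x^{v_1},\dots,x^{v_n}\}$ be a set of $n$ distinct monomials of degree $2$ in the polynomial ring $k[x_1,\dots,x_n]$. Assume that $F$ is cohesive, i.e. the elements of $F$ have no non-trivial common factor, and one cannot partition the variables as $\mathbf{x}=\mathbf{y}\sqcup\mathbf{z}$ and write $F=G\cup H$ with $G,H$ non-empty, where the monomials in $G$ involve only $\mathbf{y}$-variables and those in $H$ only $\mathbf{z}$-variables. Let $A$ be the $n\times n$ integer matrix whose columns are the exponent vectors $v_1,\dots,v_n$; let $\widetilde{\mathcal G}$ be the graph with loops on the vertices $x_1,\dots,x_n$ whose edges and loops are the pairs $\{x_i,x_j\}$ (possibly $i=j$) with $x_ix_j\in F$; and let $\mathcal G$ be the simple graph obtained from $\widetilde{\mathcal G}$ by omitting all loops. The following conditions are equivalent: (i) $\det A\neq 0$; (ii) $F$ defines a Cremona map of $\mathbb P^{n-1}_k$, i.e. the rational map $(x^{v_1}:\dots:x^{v_n})\colon\mathbb P^{n-1}_k\dashrightarrow\mathbb P^{n-1}_k$ has an inverse rational map defined over $k$; (iii) either (a) $\widetilde{\mathcal G}$ has no loops,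 and $\mathcal G$ has a unique cycle, which has odd length; or (b) $\widetilde{\mathcal G}$ is a tree with exactly one loop, i.e. $\mathcal G$ is a tree and $\widetilde{\mathcal G}$ has exactly one loop; (iv) the ideal $(F)\subset k[x_1,\dots,x_n]$ is of linear type, i.e. the canonical homomorphism from its symmetric algebra to its Rees algebra is an isomorphism. -/

import Mathlib

noncomputable section

namespace MonomialCremona

open MvPolynomial

/-! ### Cohesive sets of forms -/

/-- The polynomials in `F` have no non-trivial common factor. -/
def NoCommonFactor {σ k : Type*} [Field k] (F : Set (MvPolynomial σ k)) : Prop :=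
  ∀ p : MvPolynomial σ k, (∀ f ∈ F, p ∣ f) → IsUnit p

/-- `F` can be disconnected: the variables are partitioned into `Y` and `Z`, and `F` is the union
of two non-empty sets `G`, `H` of polynomials which only involve variables of `Y`, respectively
of `Z`. -/
def CanBeDisconnected {σ k : Type*} [Field k] (F : Set (MvPolynomial σ k)) : Prop :=
  ∃ (Y Z : Set σ) (G H : Set (MvPolynomial σ k)),
    Y ∪ Z = Set.univ ∧ Disjoint Y Z ∧ F = G ∪ H ∧ G.Nonempty ∧ H.Nonempty ∧
      (∀ g ∈ G, (g.vars : Set σ) ⊆ Y) ∧ (∀ h ∈ H, (h.vars : Set σ) ⊆ Z)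

/-- `F` is cohesive: no non-trivial common factor, and `F` cannot be disconnected. -/
def IsCohesive {σ k : Type*} [Field k] (F : Set (MvPolynomial σ k)) : Prop :=
  NoCommonFactor F ∧ ¬ CanBeDisconnected F

/-! ### Sets of monomials: monomials, log-matrix, graphs -/

/-- The monomials `x ^ (v l)`. -/
def mono {ι σ : Type*} (k : Type*) [Field k] (v : ι → σ →₀ ℕ) (l : ι) : MvPolynomial σ k :=
  monomial (v l) 1

/-- The log-matrix: its columns are the exponent vectors. -/
def logMatrix {ι σ : Type*} (v : ι → σ →₀ ℕ) : Matrix σ ι ℤ :=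
  Matrix.of fun i l => (v l i : ℤ)

/-- The edges and loops of the graph with loops attached to a set of monomials of degree two:
the unordered pairs `{i, j}` (possibly `i = j`) such that `x_i x_j` belongs to the set. -/
def edgesAndLoops {ι σ : Type*} (v : ι → σ →₀ ℕ) : Set (Sym2 σ) :=
  {e | ∃ (i j : σ) (l : ι), e = s(i, j) ∧ v l = Finsupp.single i 1 + Finsupp.single j 1}

/-- The underlying simple graph, obtained by omitting all loops. -/
def simpleGraph {ι σ : Type*} (v : ι → σ →₀ ℕ) : SimpleGraph σ :=
  SimpleGraph.fromEdgeSet (edgesAndLoops v)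

/-- The vertices that carry a loop. -/
def loops {ι σ : Type*} (v : ι → σ →₀ ℕ) : Set σ :=
  {i | s(i, i) ∈ edgesAndLoops v}

/-- The subgraph `H` is a cycle of length `m` in `G`. -/
def IsCycleSubgraph {V : Type*} {G : SimpleGraph V} (H : G.Subgraph) (m : ℕ) : Prop :=
  ∃ (u : V) (p : G.Walk u u), p.IsCycle ∧ p.length = m ∧ p.toSubgraph = H

/-- `G` has a unique cycle (as a subgraph), and the length of this cycle is odd. -/
def HasUniqueCycleOdd {V : Type*} (G : SimpleGraph V) : Prop :=
  ∃ H : G.Subgraph, (∃ m, Odd m ∧ IsCycleSubgraph H m) ∧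
    ∀ (H' : G.Subgraph) (m : ℕ), IsCycleSubgraph H' m → H' = H

/-! ### Rational maps between projective spaces -/

/-- `f` defines a rational map from the projective space with homogeneous coordinates indexed by
`σ` to the one with homogeneous coordinates indexed by `τ`: its entries are forms of one and the
same degree, not all of them zero. -/
def DefinesRationalMap {σ τ k : Type*} [Field k] (f : τ → MvPolynomial σ k) : Prop :=
  (∃ d : ℕ, ∀ j, (f j).IsHomogeneous d) ∧ ∃ j, f j ≠ 0

/-- Two (non-zero) tuples of forms define the same rational map: they are proportional. -/
def SameRationalMap {σ τ k : Type*} [Field k] (f g : τ → MvPolynomial σ k) : Prop :=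
  ∀ i j, f i * g j = f j * g i

/-- The tuple `g(f)`, which defines the composite `g ∘ f` as soon as it is non-zero. -/
def compTuple {ρ σ τ k : Type*} [Field k] (g : τ → MvPolynomial σ k)
    (f : σ → MvPolynomial ρ k) : τ → MvPolynomial ρ k :=
  fun j => bind₁ f (g j)

/-- `g ∘ f` is defined and is the identity map of projective space. -/
def CompIsId {σ k : Type*} [Field k] (g f : σ → MvPolynomial σ k) : Prop :=
  DefinesRationalMap (compTuple g f) ∧ SameRationalMap (compTuple g f) X

/-- `f` defines a Cremona map: a rational map of projective space to itself, which has an inverse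
rational map. -/
def DefinesCremona {σ k : Type*} [Field k] (f : σ → MvPolynomial σ k) : Prop :=
  DefinesRationalMap f ∧
    ∃ g : σ → MvPolynomial σ k, DefinesRationalMap g ∧ CompIsId g f ∧ CompIsId f g

/-! ### Ideals of linear type -/

/-- The inclusion of an ideal `I` as the degree one part `I t` of its Rees algebra. -/
def toRees {R : Type*} [CommRing R] (I : Ideal R) : I →ₗ[R] reesAlgebra I where
  toFun a := ⟨Polynomial.monomial 1 (a : R), reesAlgebra.monomial_mem.2 (by simp)⟩
  map_add' a b := by ext1; simp
  map_smul' r a := by ext1; simp [Polynomial.smul_monomial]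

/-- The canonical homomorphism from the symmetric algebra of an ideal to its Rees algebra. -/
def symToRees {R : Type*} [CommRing R] (I : Ideal R) :
    SymmetricAlgebra R I →ₐ[R] reesAlgebra I :=
  SymmetricAlgebra.lift (toRees I)

/-- `I` is of linear type: the canonical homomorphism from the symmetric algebra to the Rees
algebra is an isomorphism. -/
def IsOfLinearType {R : Type*} [CommRing R] (I : Ideal R) : Prop :=
  Function.Bijective (symToRees I)

end MonomialCremona

end

/-! Everything reduces to `det A ≠ 0`, read off the lattice spanned by the columns of `A`.

Graph: if `det A ≠ 0`, every variable occurs, so cohesion makes `simpleGraph v` connected. Edges and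
loops number `n` together, so there is either no loop and a single cycle, or a spanning tree and one
loop. Alternating sums of columns along a walk from `u` to `w` give `e_u ± e_w`
(`exists_mulVec_eq_of_walk`). An even cycle thus yields a kernel vector, while an odd cycle or a
loop yields `2e_u`, hence by connectedness every `2e_w`, and `det A ≠ 0`.

Cremona: in the good case all `e_i - e_j` lie in the lattice, and their preimages, shifted to be
non-negative, are the exponents of an inverse monomial map. Conversely, a kernel vector is a
multiplicative relation among the monomials, which a right inverse would turn into a relation among
the variables.

Linear type: the symmetric algebra is spanned over `k` by monomials `x^a T^α`. If `det A ≠ 0`, two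
of them with equal image in the Rees algebra are joined by linear relations (`exists_exchange`,
`symMonomial_eq`). Conversely, a kernel vector gives `T^α = T^β` there with `α ≠ β`, which is
refuted modulo the variables. -/

noncomputable section

namespace MonomialCremona

open MvPolynomial

/-! ### Quadratic monomials as edges and loops -/

section Exponents

variable {σ : Type*}

/-- The exponent vector of the monomial `x_i x_j` attached to the unordered pair `{i, j}`. -/
def pairExponent (e : Sym2 σ) : σ →₀ ℕ :=
  Sym2.lift ⟨fun i j => Finsupp.single i 1 + Finsupp.single j 1, fun _ _ => add_comm _ _⟩ e

@[simp]
theorem pairExponent_mk (i j : σ) :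
    pairExponent s(i, j) = Finsupp.single i 1 + Finsupp.single j 1 := rfl

theorem pairExponent_injective : Function.Injective (pairExponent (σ := σ)) := by
  classical
  intro e e' h
  induction e with | _ i j
  induction e' with | _ i' j'
  have h' := congrArg Finsupp.toMultiset h
  simp only [pairExponent_mk, map_add, Finsupp.toMultiset_single, one_smul] at h'
  rw [Sym2.eq_iff]
  have h2 : ({i, j} : Multiset σ) = {i', j'} := h'
  rw [Multiset.insert_eq_cons, Multiset.insert_eq_cons, Multiset.cons_eq_cons] at h2
  rcases h2 with ⟨rfl, h2⟩ | ⟨-, cs, h3, h4⟩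
  · left; exact ⟨rfl, Multiset.singleton_inj.1 h2⟩
  · right
    have h5 := congrArg Multiset.card h3
    have : cs = 0 := by
      rw [← Multiset.card_eq_zero]; simpa using h5
    subst this
    exact ⟨(Multiset.singleton_inj.1 h4).symm, Multiset.singleton_inj.1 h3⟩

theorem exists_pairExponent_eq {d : σ →₀ ℕ} (h : d.degree = 2) : ∃ e, pairExponent e = d := by
  classical
  have h1 : Multiset.card (Finsupp.toMultiset d) = 2 := by
    rw [Finsupp.card_toMultiset]; exact h
  obtain ⟨i, j, hij⟩ := Multiset.card_eq_two.1 h1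
  refine ⟨s(i, j), ?_⟩
  have h2 : Finsupp.toMultiset (pairExponent s(i, j)) = Finsupp.toMultiset d := by
    rw [hij]
    simp only [pairExponent_mk, map_add, Finsupp.toMultiset_single, one_smul]
    rfl
  have h3 := congrArg Multiset.toFinsupp h2
  rwa [Finsupp.toMultiset_toFinsupp, Finsupp.toMultiset_toFinsupp] at h3

theorem pairExponent_apply_pos {e : Sym2 σ} {x : σ} : 0 < pairExponent e x ↔ x ∈ e := by
  classical
  induction e with | _ i j
  simp only [pairExponent_mk, Finsupp.add_apply, Finsupp.single_apply, Sym2.mem_iff]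
  split_ifs <;> simp_all [eq_comm]

theorem mem_edgesAndLoops {ι : Type*} {v : ι → σ →₀ ℕ} {e : Sym2 σ} :
    e ∈ edgesAndLoops v ↔ pairExponent e ∈ Set.range v := by
  constructor
  · rintro ⟨i, j, l, rfl, h⟩
    exact ⟨l, h⟩
  · induction e with | _ i j
    rintro ⟨l, h⟩
    exact ⟨i, j, l, rfl, h⟩

theorem exists_mem_edgesAndLoops {ι : Type*} {v : ι → σ →₀ ℕ} (hdeg : ∀ l, (v l).degree = 2)
    (l : ι) : ∃ e ∈ edgesAndLoops v, pairExponent e = v l := by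
  obtain ⟨e, he⟩ := exists_pairExponent_eq (hdeg l)
  exact ⟨e, mem_edgesAndLoops.2 ⟨l, he.symm⟩, he⟩

theorem ncard_edgesAndLoops {ι : Type*} {v : ι → σ →₀ ℕ} (hinj : Function.Injective v)
    (hdeg : ∀ l, (v l).degree = 2) : (edgesAndLoops v).ncard = Nat.card ι := by
  have : edgesAndLoops v = pairExponent ⁻¹' Set.range v := by
    ext e; exact mem_edgesAndLoops
  rw [this, Set.ncard_preimage_of_injective_subset_range pairExponent_injective,
    ← Set.image_univ, Set.ncard_image_of_injective _ hinj, Set.ncard_univ]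
  rintro _ ⟨l, rfl⟩
  exact exists_pairExponent_eq (hdeg l)

theorem edgesAndLoops_finite {ι : Type*} [Finite ι] (v : ι → σ →₀ ℕ) : (edgesAndLoops v).Finite :=
  ((Set.finite_range v).preimage pairExponent_injective.injOn).subset
    fun _ he => mem_edgesAndLoops.1 he

theorem ncard_edgeSet_add_ncard_loops {ι : Type*} [Finite ι] {v : ι → σ →₀ ℕ}
    (hinj : Function.Injective v) (hdeg : ∀ l, (v l).degree = 2) :
    (simpleGraph v).edgeSet.ncard + (loops v).ncard = Nat.card ι := by
  have hfin := edgesAndLoops_finite v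
  have hdiag : Function.Injective (Sym2.diag (α := σ)) := Sym2.diag_injective
  have h1 : edgesAndLoops v = (simpleGraph v).edgeSet ∪ Sym2.diag '' loops v := by
    ext e
    simp only [simpleGraph, SimpleGraph.edgeSet_fromEdgeSet, Set.mem_union, Set.mem_sdiff,
      Set.mem_image, loops, Set.mem_ofPred_eq]
    constructor
    · intro h
      by_cases hd : e.IsDiag
      · right
        obtain ⟨i, rfl⟩ : ∃ i, Sym2.diag i = e := ⟨_, Sym2.diag_diagElem hd⟩
        exact ⟨i, h, rfl⟩
      · exact Or.inl ⟨h, hd⟩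
    · rintro (⟨h, -⟩ | ⟨i, h, rfl⟩)
      exacts [h, h]
  rw [← ncard_edgesAndLoops hinj hdeg, h1, Set.ncard_union_eq ?_
    (hfin.subset (h1 ▸ Set.subset_union_left)) (hfin.subset (h1 ▸ Set.subset_union_right)),
    Set.ncard_image_of_injective _ hdiag]
  · rw [Set.disjoint_left]
    rintro _ h ⟨i, -, rfl⟩
    exact (simpleGraph v).not_isDiag_of_mem_edgeSet h (Sym2.diag_isDiag i)

end Exponents

/-! ### Walks and the column lattice of the log-matrix -/

section Lattice

variable {σ : Type*} [Fintype σ] [DecidableEq σ] {v : σ → σ →₀ ℕ}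

omit [DecidableEq σ] in
theorem logMatrix_mulVec_apply (c : σ → ℤ) (x : σ) :
    (logMatrix v).mulVec c x = ∑ l, (v l x : ℤ) * c l := rfl

theorem logMatrix_mulVec_single (l : σ) :
    (logMatrix v).mulVec (Pi.single l 1) = fun x => (v l x : ℤ) := by
  ext x
  rw [Matrix.mulVec_single_one]
  rfl

omit [Fintype σ] in
theorem pairExponent_cast (u w : σ) :
    (fun x => ((pairExponent s(u, w) x : ℕ) : ℤ)) = Pi.single u 1 + Pi.single w 1 := by
  ext x
  simp only [pairExponent_mk, Finsupp.add_apply, Finsupp.single_apply, Pi.add_apply,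
    Pi.single_apply, Nat.cast_add, Nat.cast_ite, Nat.cast_one, Nat.cast_zero, eq_comm]

theorem eq_zero_of_logMatrix_mulVec_eq_zero (h : (logMatrix v).det ≠ 0) {c : σ → ℤ}
    (hc : (logMatrix v).mulVec c = 0) : c = 0 := by
  by_contra h0
  exact h (Matrix.exists_mulVec_eq_zero_iff.1 ⟨c, h0, hc⟩)

/-- A walk from `u` to `w` expresses `e_u ± e_w` as an alternating sum of edge vectors. -/
theorem exists_mulVec_eq_of_walk {u w : σ} (p : (simpleGraph v).Walk u w) :
    ∃ c : σ → ℤ, (logMatrix v).mulVec c = Pi.single u 1 - (-1) ^ p.length • Pi.single w 1 ∧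
      (∀ l, c l ≠ 0 → ∃ e ∈ p.edges, pairExponent e = v l) ∧
      (p.IsTrail → p.length ≠ 0 → c ≠ 0) := by
  induction p with
  | nil => exact ⟨0, by simp, by simp, by simp⟩
  | @cons a b d hab p ih =>
    obtain ⟨c, hc, hs, -⟩ := ih
    obtain ⟨l, hl⟩ := mem_edgesAndLoops.1 ((SimpleGraph.fromEdgeSet_adj _).1 hab).1
    -- `(e_a + e_b) - (e_b ± e_d) = e_a ∓ e_d`.
    refine ⟨Pi.single l 1 - c, ?_, ?_, ?_⟩
    · rw [Matrix.mulVec_sub, logMatrix_mulVec_single, hl, pairExponent_cast, hc,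
        SimpleGraph.Walk.length_cons, pow_succ]
      simp only [mul_neg, mul_one, neg_smul]
      abel
    · intro m hm
      by_cases hml : m = l
      · subst hml
        exact ⟨s(a, b), by simp, hl.symm⟩
      · have : c m ≠ 0 := by simpa [Pi.single_apply, hml] using hm
        obtain ⟨e, he, h⟩ := hs m this
        exact ⟨e, by simp [he], h⟩
    -- A trail does not reuse its first edge, so the coefficient of that edge stays `1`.
    · intro ht _ h0
      have h1 : c l = 1 := by
        have := congrFun h0 l
        simp at this
        linarith
      obtain ⟨e, he, h⟩ := hs l (by simp [h1])
      rw [SimpleGraph.Walk.isTrail_cons] at ht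
      rw [hl] at h
      exact ht.2 (pairExponent_injective h ▸ he)

/-- The alternating sum around an even closed walk is `e_u - e_u = 0`, with non-zero coefficients
since a cycle is a trail. -/
theorem even_cycle_det_eq_zero {u : σ} (p : (simpleGraph v).Walk u u) (hp : p.IsCycle)
    (heven : Even p.length) : (logMatrix v).det = 0 := by
  obtain ⟨c, hc, -, h0⟩ := exists_mulVec_eq_of_walk p
  refine Matrix.exists_mulVec_eq_zero_iff.1 ⟨c, h0 hp.isCircuit.isTrail ?_, ?_⟩
  · have := hp.three_le_length; omega
  · rw [hc, heven.neg_one_pow]; simp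

end Lattice

/-! ### Graphs with as many edges as vertices -/

section Graph

variable {V : Type*} {G : SimpleGraph V}

theorem toSubgraph_eq_of_mem_edges_iff {u u' : V} {p : G.Walk u u} {p' : G.Walk u' u'}
    (hp : ¬ p.Nil) (hp' : ¬ p'.Nil) (h : ∀ e, e ∈ p.edges ↔ e ∈ p'.edges) :
    p.toSubgraph = p'.toSubgraph := by
  refine SimpleGraph.Subgraph.ext ?_ ?_
  · ext x
    rw [SimpleGraph.Walk.mem_verts_toSubgraph, SimpleGraph.Walk.mem_verts_toSubgraph,
      SimpleGraph.Walk.mem_support_iff_exists_mem_edges_of_not_nil hp,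
      SimpleGraph.Walk.mem_support_iff_exists_mem_edges_of_not_nil hp']
    simp only [h]
  · ext x y
    rw [SimpleGraph.Walk.adj_toSubgraph_iff_mem_edges,
      SimpleGraph.Walk.adj_toSubgraph_iff_mem_edges, h]

theorem mem_edges_of_toSubgraph_eq {u u' : V} {p : G.Walk u u} {p' : G.Walk u' u'}
    (h : p.toSubgraph = p'.toSubgraph) {e : Sym2 V} (he : e ∈ p.edges) : e ∈ p'.edges := by
  induction e with | _ x y
  rw [← SimpleGraph.Walk.adj_toSubgraph_iff_mem_edges] at he ⊢
  rwa [← h]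

/-- In a connected graph with as many edges as vertices, all cycles have the same edges. -/
theorem mem_edges_of_isCycle_of_card_eq [Finite V] (hG : G.Connected)
    (hcard : G.edgeSet.ncard = Nat.card V) {u u' : V} {p : G.Walk u u} {p' : G.Walk u' u'}
    (hp : p.IsCycle) (hp' : p'.IsCycle) {e : Sym2 V} (he : e ∈ p.edges) : e ∈ p'.edges := by
  by_contra hne
  have heG := p.edges_subset_edgeSet he
  -- Deleting a cycle edge keeps `G` connected and leaves a tree by edge count; a cycle avoiding `e`
  -- would survive in it.
  have hb : ¬ G.IsBridge e := fun hb => hb.notMem_edges_of_isCycle hp he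
  have hconn : (G.deleteEdges {e}).Connected := by
    induction e with | _ x y
    exact hG.connected_delete_edge_of_not_isBridge hb
  have htree : (G.deleteEdges {e}).IsTree := by
    refine SimpleGraph.isTree_iff_connected_and_card.2 ⟨hconn, ?_⟩
    rw [Nat.card_coe_set_eq, SimpleGraph.edgeSet_deleteEdges,
      Set.ncard_sdiff_singleton_add_one heG (Set.toFinite _), hcard]
  refine htree.isAcyclic _ (SimpleGraph.Walk.IsCycle.toDeleteEdges G {e} hp' ?_)
  rintro e' he' rfl
  exact hne he'

/-- A graph with as many edges as vertices in which all cycles have the same edges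
is connected. -/
theorem connected_of_mem_edges_of_isCycle [Finite V] (hcard : G.edgeSet.ncard = Nat.card V)
    {u : V} {p : G.Walk u u} (hp : p.IsCycle)
    (h : ∀ (u' : V) (p' : G.Walk u' u'), p'.IsCycle → ∀ e ∈ p.edges, e ∈ p'.edges) :
    G.Connected := by
  have : Nonempty V := ⟨u⟩
  obtain ⟨e, he⟩ : ∃ e, e ∈ p.edges :=
    List.exists_mem_of_ne_nil _ (by
      intro h0
      have := hp.three_le_length
      rw [← SimpleGraph.Walk.length_edges, h0] at this
      simp at this)
  have heG := p.edges_subset_edgeSet he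
  have hac : (G.deleteEdges {e}).IsAcyclic := by
    intro w c hc
    have hle : G.deleteEdges {e} ≤ G := G.deleteEdges_le _
    have h1 := h w (c.mapLe hle) (hc.mapLe hle) e he
    rw [SimpleGraph.Walk.edges_mapLe_eq_edges] at h1
    have := c.edges_subset_edgeSet h1
    rw [SimpleGraph.edgeSet_deleteEdges] at this
    exact this.2 rfl
  -- The acyclic graph `G - e` extends to a spanning tree of the complete graph; both have one edge
  -- fewer than there are vertices, so they coincide.
  obtain ⟨F, hF, -, hT⟩ :=
    (SimpleGraph.connected_top (V := V)).exists_isTree_le_of_le_of_isAcyclic le_top hac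
  have h1 := (SimpleGraph.isTree_iff_connected_and_card.1 hT).2
  have h2 : (G.deleteEdges {e}).edgeSet.ncard + 1 = Nat.card V := by
    rw [SimpleGraph.edgeSet_deleteEdges,
      Set.ncard_sdiff_singleton_add_one heG (Set.toFinite _), hcard]
  have h3 : (G.deleteEdges {e}).edgeSet = F.edgeSet := by
    refine Set.eq_of_subset_of_ncard_le (SimpleGraph.edgeSet_mono hF) ?_ (Set.toFinite _)
    rw [Nat.card_coe_set_eq] at h1
    omega
  rw [SimpleGraph.edgeSet_inj] at h3
  rw [← h3] at hT
  exact hT.connected.mono (G.deleteEdges_le _)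

end Graph

/-! ### Determinant versus shape of the graph -/

section Conditions

variable {σ : Type*} [Fintype σ] [DecidableEq σ] {v : σ → σ →₀ ℕ}

theorem exists_apply_pos_of_det_ne_zero (hdet : (logMatrix v).det ≠ 0) (x : σ) :
    ∃ l, 0 < v l x := by
  by_contra! h
  refine hdet (Matrix.det_eq_zero_of_row_eq_zero x fun l => ?_)
  have := h l
  simp only [logMatrix, Matrix.of_apply]
  exact_mod_cast Nat.le_zero.1 this

omit [Fintype σ] [DecidableEq σ] in
theorem reachable_of_apply_pos (hdeg : ∀ l, (v l).degree = 2) {l x y : σ}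
    (hx : 0 < v l x) (hy : 0 < v l y) : (simpleGraph v).Reachable x y := by
  by_cases hxy : x = y
  · exact hxy ▸ SimpleGraph.Reachable.refl x
  obtain ⟨e, he, hel⟩ := exists_mem_edgesAndLoops hdeg l
  rw [← hel, pairExponent_apply_pos] at hx hy
  have : e = s(x, y) := (Sym2.mem_and_mem_iff hxy).1 ⟨hx, hy⟩
  exact SimpleGraph.Adj.reachable ((SimpleGraph.fromEdgeSet_adj _).2 ⟨this ▸ he, hxy⟩)

/-- Otherwise the component of `u` and its complement split the variables. Both sides carry
monomials because no row of the matrix is zero. -/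
theorem connected_of_det_ne_zero {k : Type*} [Field k] [Nonempty σ]
    (hdeg : ∀ l, (v l).degree = 2) (hcon : ¬ CanBeDisconnected (Set.range (mono k v)))
    (hdet : (logMatrix v).det ≠ 0) : (simpleGraph v).Connected := by
  refine ⟨fun u w => ?_⟩
  by_contra hn
  refine hcon ?_
  have hvars : ∀ l, ((mono k v l).vars : Set σ) = {x | 0 < v l x} := by
    intro l
    ext x
    rw [mono, vars_monomial one_ne_zero]
    simp [Nat.pos_iff_ne_zero]
  obtain ⟨lu, hlu⟩ := exists_apply_pos_of_det_ne_zero hdet u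
  obtain ⟨lw, hlw⟩ := exists_apply_pos_of_det_ne_zero hdet w
  refine ⟨{x | (simpleGraph v).Reachable u x}, {x | ¬ (simpleGraph v).Reachable u x},
    mono k v '' {l | ∃ x, 0 < v l x ∧ (simpleGraph v).Reachable u x},
    mono k v '' {l | ∃ x, 0 < v l x ∧ ¬ (simpleGraph v).Reachable u x},
    ?_, ?_, ?_, ⟨_, lu, ⟨u, hlu, .refl u⟩, rfl⟩, ⟨_, lw, ⟨w, hlw, hn⟩, rfl⟩, ?_, ?_⟩
  · ext x; simp [em]
  · rw [Set.disjoint_left]; intro x hx hx'; exact hx' hx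
  · rw [← Set.image_union, ← Set.image_univ]
    congr 1
    symm
    rw [Set.eq_univ_iff_forall]
    intro l
    obtain ⟨x, hx⟩ : ∃ x, 0 < v l x := by
      by_contra! h
      have : v l = 0 := by ext x; simpa using h x
      have h2 := hdeg l
      rw [this] at h2
      simp at h2
    by_cases hr : (simpleGraph v).Reachable u x
    exacts [Or.inl ⟨x, hx, hr⟩, Or.inr ⟨x, hx, hr⟩]
  · rintro _ ⟨l, ⟨x, hx, hr⟩, rfl⟩
    rw [hvars]
    intro y hy
    exact hr.trans (reachable_of_apply_pos hdeg hx hy)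
  · rintro _ ⟨l, ⟨x, hx, hr⟩, rfl⟩
    rw [hvars]
    intro y hy hy'
    exact hr (hy'.trans (reachable_of_apply_pos hdeg hy hx))

theorem isTree_or_hasUniqueCycleOdd_of_det_ne_zero (hinj : Function.Injective v)
    (hdeg : ∀ l, (v l).degree = 2) (hG : (simpleGraph v).Connected)
    (hdet : (logMatrix v).det ≠ 0) :
    (loops v = ∅ ∧ HasUniqueCycleOdd (simpleGraph v)) ∨
      ((simpleGraph v).IsTree ∧ ∃! i, i ∈ loops v) := by
  have hcard := ncard_edgeSet_add_ncard_loops hinj hdeg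
  have hle := hG.card_vert_le_card_edgeSet_add_one
  rw [Nat.card_coe_set_eq] at hle
  by_cases h0 : loops v = ∅
  · refine Or.inl ⟨h0, ?_⟩
    rw [h0, Set.ncard_empty, add_zero] at hcard
    have hnt : ¬ (simpleGraph v).IsAcyclic := by
      intro hac
      have := (SimpleGraph.isTree_iff_connected_and_card.1 ⟨hG, hac⟩).2
      rw [Nat.card_coe_set_eq] at this
      omega
    simp only [SimpleGraph.IsAcyclic, not_forall, not_not] at hnt
    obtain ⟨u, p, hp⟩ := hnt
    refine ⟨p.toSubgraph, ⟨p.length, ?_, u, p, hp, rfl, rfl⟩, ?_⟩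
    · by_contra hev
      exact hdet (even_cycle_det_eq_zero p hp (Nat.not_odd_iff_even.1 hev))
    · rintro _ m ⟨u', p', hp', -, rfl⟩
      exact toSubgraph_eq_of_mem_edges_iff hp'.not_nil hp.not_nil fun e =>
        ⟨mem_edges_of_isCycle_of_card_eq hG hcard hp' hp,
          mem_edges_of_isCycle_of_card_eq hG hcard hp hp'⟩
  · have h1 : 0 < (loops v).ncard :=
      (Set.ncard_pos (Set.toFinite _)).2 (Set.nonempty_iff_ne_empty.2 h0)
    refine Or.inr ⟨SimpleGraph.isTree_iff_connected_and_card.2 ⟨hG, ?_⟩, ?_⟩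
    · rw [Nat.card_coe_set_eq]; omega
    · obtain ⟨i, hi⟩ := Set.ncard_eq_one.1 (show (loops v).ncard = 1 by omega)
      exact ⟨i, by simp [hi], fun j hj => by simpa [hi] using hj⟩

/-- The alternating sum around an odd cycle based at `u`, or the loop column at `u`, equals `2e_u`.
In the cyclic case connectedness comes from the edge count. -/
theorem connected_and_exists_mulVec_eq_two (hinj : Function.Injective v)
    (hdeg : ∀ l, (v l).degree = 2)
    (h : (loops v = ∅ ∧ HasUniqueCycleOdd (simpleGraph v)) ∨
      ((simpleGraph v).IsTree ∧ ∃! i, i ∈ loops v)) :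
    (simpleGraph v).Connected ∧
      ∃ (u : σ) (c : σ → ℤ), (logMatrix v).mulVec c = (2 : ℤ) • Pi.single u 1 := by
  rcases h with ⟨h0, H, ⟨m, hm, u, p, hp, rfl, rfl⟩, huniq⟩ | ⟨hT, i, hi, -⟩
  · have hcard := ncard_edgeSet_add_ncard_loops hinj hdeg
    rw [h0, Set.ncard_empty, add_zero] at hcard
    refine ⟨connected_of_mem_edges_of_isCycle hcard hp fun u' p' hp' e he => ?_, u, ?_⟩
    · exact mem_edges_of_toSubgraph_eq (huniq _ _ ⟨u', p', hp', rfl, rfl⟩).symm he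
    · obtain ⟨c, hc, -, -⟩ := exists_mulVec_eq_of_walk p
      refine ⟨c, ?_⟩
      rw [hc, hm.neg_one_pow, two_smul]
      simp
  · obtain ⟨l, hl⟩ := mem_edgesAndLoops.1 hi
    refine ⟨hT.connected, i, Pi.single l 1, ?_⟩
    rw [logMatrix_mulVec_single, hl, pairExponent_cast, two_smul]

/-- Transport along a walk: `2e_w = 2(e_w ± e_u) ∓ 2e_u`. -/
theorem exists_mulVec_eq_two (hG : (simpleGraph v).Connected)
    (h : ∃ (u : σ) (c : σ → ℤ), (logMatrix v).mulVec c = (2 : ℤ) • Pi.single u 1) (w : σ) :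
    ∃ c : σ → ℤ, (logMatrix v).mulVec c = (2 : ℤ) • Pi.single w 1 := by
  obtain ⟨u, c, hc⟩ := h
  obtain ⟨p⟩ := hG.preconnected w u
  obtain ⟨d, hd, -, -⟩ := exists_mulVec_eq_of_walk p
  refine ⟨(2 : ℤ) • d + (-1 : ℤ) ^ p.length • c, ?_⟩
  rw [Matrix.mulVec_add, Matrix.mulVec_smul, Matrix.mulVec_smul, hc, hd]
  module

theorem det_ne_zero_of_connected (hG : (simpleGraph v).Connected)
    (h : ∃ (u : σ) (c : σ → ℤ), (logMatrix v).mulVec c = (2 : ℤ) • Pi.single u 1) :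
    (logMatrix v).det ≠ 0 := by
  choose c hc using exists_mulVec_eq_two hG h
  have h2 : logMatrix v * (Matrix.of c).transpose = (2 : ℤ) • (1 : Matrix σ σ ℤ) := by
    ext x w
    have := congrFun (hc w) x
    simp only [Matrix.mulVec, dotProduct, Pi.smul_apply, Pi.single_apply] at this
    simp only [Matrix.mul_apply, Matrix.transpose_apply, Matrix.of_apply, Matrix.smul_apply,
      Matrix.one_apply]
    exact this
  intro h0
  have h3 := congrArg Matrix.det h2
  rw [Matrix.det_mul, h0, zero_mul, Matrix.det_smul, Matrix.det_one, mul_one] at h3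
  exact pow_ne_zero _ two_ne_zero h3.symm

/-- An even walk gives the difference directly; an odd one gives `e_i + e_j`, from which `2e_j` is
subtracted. -/
theorem exists_mulVec_eq_single_sub_single (hG : (simpleGraph v).Connected)
    (h : ∃ (u : σ) (c : σ → ℤ), (logMatrix v).mulVec c = (2 : ℤ) • Pi.single u 1) (i j : σ) :
    ∃ c : σ → ℤ, (logMatrix v).mulVec c = Pi.single i 1 - Pi.single j 1 := by
  obtain ⟨p⟩ := hG.preconnected i j
  obtain ⟨d, hd, -, -⟩ := exists_mulVec_eq_of_walk p
  obtain ⟨c, hc⟩ := exists_mulVec_eq_two hG h j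
  rcases Nat.even_or_odd p.length with hp | hp
  · exact ⟨d, by rw [hd, hp.neg_one_pow, one_smul]⟩
  · refine ⟨d - c, ?_⟩
    rw [Matrix.mulVec_sub, hd, hc, hp.neg_one_pow]
    module

end Conditions

/-! ### Monomial Cremona maps -/

section Cremona

variable {σ : Type*} [Fintype σ] {v : σ → σ →₀ ℕ}

theorem sum_smul_apply {ι τ : Type*} [Fintype ι] (d : ι → ℕ) (w : ι → τ →₀ ℕ) (x : τ) :
    (∑ l, d l • w l) x = ∑ l, d l * w l x := by
  simp [Finsupp.finsetSum_apply]

theorem degree_sum_smul {ι τ : Type*} [Fintype ι] {w : ι → τ →₀ ℕ} {m : ℕ}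
    (hw : ∀ l, (w l).degree = m) (d : ι → ℕ) :
    (∑ l, d l • w l).degree = (∑ l, d l) * m := by
  rw [map_sum, Finset.sum_mul]
  exact Finset.sum_congr rfl fun l _ => by rw [map_nsmul, hw, smul_eq_mul]

theorem prod_monomial_pow {ι τ k : Type*} [Fintype ι] [Field k] (d : ι → ℕ) (w : ι → τ →₀ ℕ) :
    ∏ l, (monomial (w l) (1 : k)) ^ d l = monomial (∑ l, d l • w l) 1 := by
  rw [monomial_sum_one]
  exact Finset.prod_congr rfl fun l _ => by rw [monomial_pow, one_pow]

theorem bind₁_monomial_one {ι τ k : Type*} [Fintype ι] [Field k] (f : ι → MvPolynomial τ k)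
    (d : ι →₀ ℕ) : bind₁ f (monomial d 1) = ∏ l, f l ^ d l := by
  rw [bind₁_monomial, C_1, one_mul]
  exact Finset.prod_subset (Finset.subset_univ _) fun l _ hl => by
    rw [Finsupp.notMem_support_iff.1 hl, pow_zero]

theorem compTuple_mono {k : Type*} [Field k] (w v : σ → σ →₀ ℕ) (j : σ) :
    compTuple (mono k w) (mono k v) j = monomial (∑ l, w j l • v l) 1 := by
  rw [compTuple, mono, bind₁_monomial_one]
  exact prod_monomial_pow _ _

omit [Fintype σ] in
theorem definesRationalMap_monomial {k : Type*} [Field k] [Nonempty σ] {w : σ → σ →₀ ℕ} {m : ℕ}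
    (h : ∀ j, (w j).degree = m) :
    DefinesRationalMap fun j => (monomial (w j) 1 : MvPolynomial σ k) :=
  ⟨⟨m, fun j => isHomogeneous_monomial _ (h j)⟩, Classical.arbitrary σ, by simp⟩

omit [Fintype σ] in
theorem sameRationalMap_monomial_X {k : Type*} [Field k] {w : σ → σ →₀ ℕ}
    (h : ∀ i j, w i + Finsupp.single j 1 = w j + Finsupp.single i 1) :
    SameRationalMap (fun j => (monomial (w j) 1 : MvPolynomial σ k)) X := by
  intro i j
  simp only [X, monomial_mul, h i j]

theorem sum_apply_eq_of_degree_eq {d : σ →₀ ℕ} {m : ℕ} (h : d.degree = m) : ∑ x, d x = m := by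
  rw [← h, Finsupp.degree_eq_sum]

variable [DecidableEq σ]

omit [DecidableEq σ] in
theorem logMatrix_mulVec_natCast (d : σ → ℕ) :
    (logMatrix v).mulVec (fun l => (d l : ℤ)) = fun x => (((∑ l, d l • v l) x : ℕ) : ℤ) := by
  ext x
  rw [logMatrix_mulVec_apply, sum_smul_apply]
  push_cast
  exact Finset.sum_congr rfl fun _ _ => mul_comm _ _

theorem eq_of_sum_smul_eq (hdet : (logMatrix v).det ≠ 0) {α β : σ → ℕ}
    (h : ∑ l, α l • v l = ∑ l, β l • v l) : α = β := by
  have h0 := eq_zero_of_logMatrix_mulVec_eq_zero hdet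
    (c := (fun l => (α l : ℤ)) - fun l => (β l : ℤ)) (by
      rw [Matrix.mulVec_sub, logMatrix_mulVec_natCast, logMatrix_mulVec_natCast, h, sub_self])
  ext l
  have := congrFun h0 l
  simp only [Pi.sub_apply, Pi.zero_apply] at this
  omega

/-- Positive and negative parts of an integral kernel vector; the totals agree because all columns
have the same degree. -/
theorem exists_sum_smul_eq_of_det_eq_zero (hdeg : ∀ l, (v l).degree = 2)
    (hdet : (logMatrix v).det = 0) :
    ∃ α β : σ → ℕ, α ≠ β ∧ ∑ l, α l • v l = ∑ l, β l • v l ∧ ∑ l, α l = ∑ l, β l := by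
  obtain ⟨c, hc0, hc⟩ := Matrix.exists_mulVec_eq_zero_iff.2 hdet
  have hsub : c = (fun l => ((c l).toNat : ℤ)) - fun l => ((-c l).toNat : ℤ) := by
    ext l; simp only [Pi.sub_apply]; omega
  have heq : ∑ l, (c l).toNat • v l = ∑ l, (-c l).toNat • v l := by
    ext x
    have h1 := hc
    rw [hsub, Matrix.mulVec_sub, logMatrix_mulVec_natCast, logMatrix_mulVec_natCast] at h1
    have := congrFun h1 x
    simp only [Pi.sub_apply, Pi.zero_apply] at this
    omega
  refine ⟨fun l => (c l).toNat, fun l => (-c l).toNat, fun h => hc0 ?_, heq, ?_⟩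
  · ext l
    have := congrFun h l
    simp only [Pi.zero_apply] at this ⊢
    omega
  · have := congrArg Finsupp.degree heq
    rw [degree_sum_smul hdeg, degree_sum_smul hdeg] at this
    exact Nat.eq_of_mul_eq_mul_right two_pos this

theorem det_ne_zero_of_compIsId {k : Type*} [Field k] (hdeg : ∀ l, (v l).degree = 2)
    {g : σ → MvPolynomial σ k} (h : CompIsId (mono k v) g) : (logMatrix v).det ≠ 0 := by
  intro hdet
  obtain ⟨α, β, hne, heq, hsum⟩ := exists_sum_smul_eq_of_det_eq_zero hdeg hdet
  obtain ⟨⟨-, j, hj⟩, hsame⟩ := h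
  set F := compTuple (mono k v) g with hF
  -- Multiply the proportionalities `F_l x_j = F_j x_l` over `l` with exponents `γ l`. Since `F_j ≠
  -- 0`, a relation among the `F_l` becomes one among the `x_l`.
  have hprod : ∀ γ : σ → ℕ, (∏ l, F l ^ γ l) * X j ^ (∑ l, γ l) =
      F j ^ (∑ l, γ l) * monomial (Finsupp.equivFunOnFinite.symm γ) 1 := by
    intro γ
    rw [monomial_eq, C_1, one_mul, Finsupp.prod_fintype _ _ (fun _ => pow_zero _),
      ← Finset.prod_pow_eq_pow_sum, ← Finset.prod_pow_eq_pow_sum, ← Finset.prod_mul_distrib,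
      ← Finset.prod_mul_distrib]
    refine Finset.prod_congr rfl fun l _ => ?_
    rw [Finsupp.equivFunOnFinite_symm_apply_apply, ← mul_pow, ← mul_pow, hsame l j]
  have hpow : ∀ γ : σ → ℕ, ∏ l, F l ^ γ l = bind₁ g (monomial (∑ l, γ l • v l) 1) := by
    intro γ
    rw [← prod_monomial_pow, map_prod]
    exact Finset.prod_congr rfl fun l _ => by rw [map_pow]; rfl
  have h1 := hprod α
  rw [hpow, heq, ← hpow, hsum, hprod β] at h1
  have h2 := mul_left_cancel₀ (pow_ne_zero _ hj) h1
  have h3 := monomial_left_injective (one_ne_zero (α := k)) h2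
  exact hne (Finsupp.equivFunOnFinite.symm.injective h3).symm

theorem definesCremona_of_mulVec {k : Type*} [Field k] [Nonempty σ]
    (hdeg : ∀ l, (v l).degree = 2) (hdet : (logMatrix v).det ≠ 0)
    (h : ∀ i j, ∃ c : σ → ℤ, (logMatrix v).mulVec c = Pi.single i 1 - Pi.single j 1) :
    DefinesCremona (mono k v) := by
  obtain ⟨j₀⟩ := ‹Nonempty σ›
  have : Nonempty σ := ⟨j₀⟩
  choose u hu using fun j => h j j₀
  -- A uniform shift by `N` makes all exponents non-negative, so `toNat` loses nothing; it changes
  -- every image by the same vector, absorbed in `δ`.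
  obtain ⟨N, hN⟩ := Finite.exists_le fun p : σ × σ => -u p.1 p.2
  let w : σ → σ →₀ ℕ := fun j => Finsupp.equivFunOnFinite.symm fun l => (u j l + N).toNat
  have hw : ∀ j, (fun l => (w j l : ℤ)) = u j + fun _ => N := by
    intro j; ext l
    have := hN (j, l)
    simp only [w, Finsupp.equivFunOnFinite_symm_apply_apply, Pi.add_apply] at this ⊢
    omega
  obtain ⟨δ, hδ⟩ : ∃ δ : σ → ℤ, ∀ j, (logMatrix v).mulVec (fun l => (w j l : ℤ)) =
      Pi.single j 1 + δ := by
    refine ⟨(logMatrix v).mulVec (fun _ => N) - Pi.single j₀ 1, fun j => ?_⟩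
    rw [hw, Matrix.mulVec_add, hu]
    abel
  have hgf : ∀ i j, ∑ l, w i l • v l + Finsupp.single j 1 =
      ∑ l, w j l • v l + Finsupp.single i 1 := by
    intro i j
    ext x
    have h1 := congrFun ((logMatrix_mulVec_natCast (v := v) (w i)).symm.trans (hδ i)) x
    have h2 := congrFun ((logMatrix_mulVec_natCast (v := v) (w j)).symm.trans (hδ j)) x
    simp only [Pi.add_apply, Pi.single_apply] at h1 h2
    simp only [Finsupp.add_apply, Finsupp.single_apply, eq_comm (b := x)]
    refine Nat.cast_injective (R := ℤ) ?_
    rw [Nat.cast_add, Nat.cast_add, h1, h2]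
    push_cast
    ring
  obtain ⟨m, hm⟩ : ∃ m, ∀ j, (w j).degree = m := by
    refine ⟨(w j₀).degree, fun j => ?_⟩
    have h1 := congrArg Finsupp.degree (hgf j j₀)
    simp only [map_add, degree_sum_smul hdeg, Finsupp.degree_single] at h1
    rw [Finsupp.degree_eq_sum, Finsupp.degree_eq_sum]
    omega
  have hfg : ∀ i j, ∑ l, v i l • w l + Finsupp.single j 1 =
      ∑ l, v j l • w l + Finsupp.single i 1 := by
    intro i j
    -- The exponents of `f ∘ g` minus `e_i` have image `2δ` under `A`, independent of `i`;
    -- injectivity of `A` then makes these differences equal.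
    have key : ∀ i, (logMatrix v).mulVec (∑ l, (v i l : ℤ) • fun x => (w l x : ℤ)) =
        (logMatrix v).mulVec (Pi.single i 1) + (2 : ℤ) • δ := by
      intro i
      rw [Matrix.mulVec_sum, logMatrix_mulVec_single]
      have h2 : (∑ l, (v i l : ℤ)) = 2 := by
        exact_mod_cast sum_apply_eq_of_degree_eq (hdeg i)
      rw [← h2, Finset.sum_smul]
      simp only [Matrix.mulVec_smul, hδ, smul_add, Finset.sum_add_distrib]
      congr 1
      ext x
      simp [Finset.sum_apply, Pi.single_apply]
    have h0 := eq_zero_of_logMatrix_mulVec_eq_zero hdet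
      (c := ((∑ l, (v i l : ℤ) • fun x => (w l x : ℤ)) - Pi.single i 1) -
        ((∑ l, (v j l : ℤ) • fun x => (w l x : ℤ)) - Pi.single j 1)) (by
        simp only [Matrix.mulVec_sub, key]
        abel)
    ext x
    have h1 := congrFun h0 x
    simp only [Pi.sub_apply, Finset.sum_apply, Pi.smul_apply, Pi.single_apply, Pi.zero_apply,
      smul_eq_mul] at h1
    simp only [Finsupp.add_apply, Finsupp.single_apply, sum_smul_apply, eq_comm (b := x)]
    zify
    linarith
  refine ⟨definesRationalMap_monomial hdeg, mono k w, definesRationalMap_monomial hm, ?_, ?_⟩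
  · rw [CompIsId, funext (compTuple_mono w v)]
    exact ⟨definesRationalMap_monomial (m := m * 2) fun j => by
      rw [degree_sum_smul hdeg, ← Finsupp.degree_eq_sum, hm], sameRationalMap_monomial_X hgf⟩
  · rw [CompIsId, funext (compTuple_mono v w)]
    exact ⟨definesRationalMap_monomial (m := 2 * m) fun j => by
      rw [degree_sum_smul hm, ← Finsupp.degree_eq_sum, hdeg], sameRationalMap_monomial_X hfg⟩

end Cremona

/-! ### Exchange between two products of edges -/

section LinearType

section Exchange

variable {σ : Type*} [Fintype σ] {v : σ → σ →₀ ℕ}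

/-- At a vertex missed by the `β` edges, the whole exponent on the right comes from `b`. -/
theorem le_of_pure_vertex {α β : σ → ℕ} {a b : σ →₀ ℕ}
    (h : a + ∑ l, α l • v l = b + ∑ l, β l • v l) {e x : σ} (he : 0 < α e)
    (hx : ∀ j, 0 < β j → v j x = 0) : v e x ≤ b x := by
  have h1 := DFunLike.congr_fun h x
  rw [Finsupp.add_apply, Finsupp.add_apply, sum_smul_apply, sum_smul_apply,
    Finset.sum_eq_zero (f := fun l => β l * v l x)] at h1
  · have h2 : α e * v e x ≤ ∑ l, α l * v l x :=
      Finset.single_le_sum (f := fun l => α l * v l x) (fun _ _ => Nat.zero_le _)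
        (Finset.mem_univ e)
    have h3 : v e x ≤ α e * v e x := Nat.le_mul_of_pos_left _ he
    omega
  · intro l _
    rcases Nat.eq_zero_or_pos (β l) with h0 | h0
    · rw [h0, zero_mul]
    · rw [hx l h0, mul_zero]

/-- If all vertices of `e` are missed by the `β` edges, `b` alone dominates `v e`. Otherwise `e =
{u, w}` with `w ≠ u`: `b` supplies `u` and an edge `j` through `w` supplies `w`. -/
theorem exists_le_add_of_pure_vertex (hdeg : ∀ l, (v l).degree = 2) {α β : σ → ℕ} {a b : σ →₀ ℕ}
    (h : a + ∑ l, α l • v l = b + ∑ l, β l • v l) {e u j₀ : σ} (he : 0 < α e) (hu : 0 < v e u)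
    (hpure : ∀ j, 0 < β j → v j u = 0) (hj₀ : 0 < β j₀) : ∃ j, 0 < β j ∧ v e ≤ b + v j := by
  classical
  by_cases hall : ∀ x, 0 < v e x → ∀ j, 0 < β j → v j x = 0
  · refine ⟨j₀, hj₀, fun x => ?_⟩
    rcases Nat.eq_zero_or_pos (v e x) with h0 | h0
    · rw [h0]; exact Nat.zero_le _
    · exact (le_of_pure_vertex h he (hall x h0)).trans (Nat.le_add_right _ _)
  · push Not at hall
    obtain ⟨w, hw, j, hj, hjw⟩ := hall
    have huw : u ≠ w := fun huw => hjw (huw ▸ hpure j hj)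
    have hb := le_of_pure_vertex h he hpure
    refine ⟨j, hj, fun x => ?_⟩
    obtain ⟨e', he'⟩ := exists_pairExponent_eq (hdeg e)
    rw [← he', pairExponent_apply_pos] at hu hw
    rw [(Sym2.mem_and_mem_iff huw).1 ⟨hu, hw⟩, pairExponent_mk] at he'
    rw [← he'] at hb ⊢
    simp only [Finsupp.add_apply, Finsupp.single_apply] at hb ⊢
    by_cases hxu : u = x
    · subst hxu
      simp only [if_neg huw.symm, ↓reduceIte, add_zero] at hb ⊢
      omega
    · by_cases hxw : w = x
      · subst hxw
        simp only [if_neg huw, if_true]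
        omega
      · simp [hxu, hxw]

/-- The columns in `S` are independent and vanish outside the rows in `U`. -/
theorem card_le_card_of_det_ne_zero [DecidableEq σ] (hdet : (logMatrix v).det ≠ 0) {S U : Finset σ}
    (h : ∀ l ∈ S, ∀ x, 0 < v l x → x ∈ U) : S.card ≤ U.card := by
  have hinj : Function.Injective
      ((logMatrix v).submatrix (Subtype.val : U → σ) (Subtype.val : S → σ)).mulVecLin := by
    rw [← LinearMap.ker_eq_bot, LinearMap.ker_eq_bot']
    intro c hc
    let c' : σ → ℤ := fun l => if hl : l ∈ S then c ⟨l, hl⟩ else 0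
    have hc' : c' = 0 := by
      refine eq_zero_of_logMatrix_mulVec_eq_zero hdet ?_
      ext x
      rw [logMatrix_mulVec_apply, Pi.zero_apply,
        ← Finset.sum_subset (Finset.subset_univ S) (fun l _ hl => by simp [c', hl])]
      by_cases hx : x ∈ U
      · rw [← Finset.sum_coe_sort S]
        have h1 := congrFun hc ⟨x, hx⟩
        simp only [Matrix.mulVecLin_apply, Matrix.mulVec, dotProduct, Matrix.submatrix_apply,
          Pi.zero_apply] at h1
        rw [← h1]
        exact Finset.sum_congr rfl fun l _ => by simp [c', logMatrix]
      · refine Finset.sum_eq_zero fun l hl => ?_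
        have : v l x = 0 := by
          by_contra h0
          exact hx (h l hl x (Nat.pos_of_ne_zero h0))
        simp [this]
    ext l
    have := congrFun hc' l
    simpa [c'] using this
  simpa using card_le_of_injective ℤ _ hinj

/-- If the two sides have no edge in common and every vertex on an edge of one side is on an edge
of the other, the supports carry a non-trivial linear relation. -/
theorem det_eq_zero_of_forall_mem_iff [DecidableEq σ] (hdeg : ∀ l, (v l).degree = 2) {α β : σ → ℕ}
    (hdisj : ∀ l, 0 < α l → β l = 0) {e : σ} (he : 0 < α e)
    (hiff : ∀ x, (∃ l, 0 < α l ∧ 0 < v l x) ↔ ∃ l, 0 < β l ∧ 0 < v l x) :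
    (logMatrix v).det = 0 := by
  by_contra hdet
  let χ : (σ → ℕ) → σ → ℕ := fun γ l => if 0 < γ l then 1 else 0
  let S : Finset σ := Finset.univ.filter fun l => 0 < α l ∨ 0 < β l
  let U : Finset σ := Finset.univ.filter fun x => ∃ l, 0 < α l ∧ 0 < v l x
  have hSU : S.card ≤ U.card := by
    refine card_le_card_of_det_ne_zero hdet fun l hl x hx => ?_
    simp only [S, U, Finset.mem_filter, Finset.mem_univ, true_and] at hl ⊢
    rcases hl with hl | hl
    exacts [⟨l, hl, hx⟩, (hiff x).2 ⟨l, hl, hx⟩]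
  have hpos : ∀ (γ : σ → ℕ) (x : σ), (∃ l, 0 < γ l ∧ 0 < v l x) ↔ 0 < ∑ l, χ γ l * v l x := by
    intro γ x
    rw [Nat.pos_iff_ne_zero, Ne, Finset.sum_eq_zero_iff]
    simp only [χ, Finset.mem_univ, true_imp_iff, not_forall]
    refine exists_congr fun l => ?_
    split_ifs with h0 <;> simp [h0, Nat.pos_iff_ne_zero]
  have hS : ∑ l, χ α l + ∑ l, χ β l = S.card := by
    rw [Finset.card_filter, ← Finset.sum_add_distrib]
    refine Finset.sum_congr rfl fun l _ => ?_
    have := hdisj l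
    simp only [χ]
    split_ifs <;> omega
  have hle : ∀ x ∈ Finset.univ, (if x ∈ U then 2 else 0) ≤
      ∑ l, χ α l * v l x + ∑ l, χ β l * v l x := by
    intro x _
    split_ifs with hx
    · simp only [U, Finset.mem_filter, Finset.mem_univ, true_and] at hx
      have h1 := (hpos α x).1 hx
      have h2 := (hpos β x).1 ((hiff x).1 hx)
      omega
    · exact Nat.zero_le _
  have htot : ∀ γ : σ → ℕ, ∑ x, ∑ l, χ γ l * v l x = (∑ l, χ γ l) * 2 := by
    intro γ
    rw [← degree_sum_smul hdeg, Finsupp.degree_eq_sum]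
    exact Finset.sum_congr rfl fun x _ => (sum_smul_apply _ _ _).symm
  -- Double counting: each vertex of `U` has degree at least one on either side, while the total
  -- degree is `2|S| ≤ 2|U|`. Equality forces degree one on each side, so the two indicators have
  -- equal image.
  have hsum : ∑ x, (if x ∈ U then 2 else 0) =
      ∑ x, (∑ l, χ α l * v l x + ∑ l, χ β l * v l x) := by
    refine le_antisymm (Finset.sum_le_sum hle) ?_
    rw [Finset.sum_add_distrib, htot, htot, ← add_mul, hS, Finset.sum_ite_mem,
      Finset.univ_inter, Finset.sum_const, smul_eq_mul]
    exact Nat.mul_le_mul_right _ hSU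
  have heq := (Finset.sum_eq_sum_iff_of_le hle).1 hsum
  have hχ : χ α = χ β := by
    refine eq_of_sum_smul_eq hdet ?_
    ext x
    rw [sum_smul_apply, sum_smul_apply]
    have h1 := heq x (Finset.mem_univ x)
    have h2 := hpos α x
    have h3 := hpos β x
    rw [← hiff x] at h3
    by_cases hx : ∃ l, 0 < α l ∧ 0 < v l x
    · rw [if_pos (by simpa [U] using hx)] at h1
      have := h2.1 hx
      have := h3.1 hx
      omega
    · rw [iff_false_left hx] at h2 h3
      omega
  have h1 := congrFun hχ e
  simp [χ, he, hdisj e he] at h1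

/-- A common edge serves at once. Otherwise `det_eq_zero_of_forall_mem_iff` provides a vertex met by
one side only, and an edge through it can be exchanged. -/
theorem exists_exchange [DecidableEq σ] (hdeg : ∀ l, (v l).degree = 2)
    (hdet : (logMatrix v).det ≠ 0) {α β : σ → ℕ} {a b : σ →₀ ℕ}
    (h : a + ∑ l, α l • v l = b + ∑ l, β l • v l)
    (hα : 0 < ∑ l, α l) (hβ : 0 < ∑ l, β l) :
    ∃ e j, 0 < α e ∧ 0 < β j ∧ (v e ≤ b + v j ∨ v j ≤ a + v e) := by
  obtain ⟨e₀, -, he₀⟩ := Finset.sum_pos_iff.1 hα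
  obtain ⟨j₀, -, hj₀⟩ := Finset.sum_pos_iff.1 hβ
  by_cases hdisj : ∀ l, 0 < α l → β l = 0
  · by_contra hno
    refine hdet (det_eq_zero_of_forall_mem_iff hdeg hdisj he₀ fun x => ⟨?_, ?_⟩)
    · rintro ⟨e, he, hx⟩
      by_contra hpure
      push Not at hpure
      obtain ⟨j, hj, hle⟩ := exists_le_add_of_pure_vertex hdeg h he hx
        (fun j hj => Nat.le_zero.1 (hpure j hj)) hj₀
      exact hno ⟨e, j, he, hj, Or.inl hle⟩
    · rintro ⟨j, hj, hx⟩
      by_contra hpure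
      push Not at hpure
      obtain ⟨e, he, hle⟩ := exists_le_add_of_pure_vertex hdeg h.symm hj hx
        (fun j hj => Nat.le_zero.1 (hpure j hj)) he₀
      exact hno ⟨e, j, he, hj, Or.inr hle⟩
  · push Not at hdisj
    obtain ⟨l, hl, hl'⟩ := hdisj
    exact ⟨l, l, hl, Nat.pos_of_ne_zero hl', Or.inl le_add_self⟩

end Exchange

/-! ### Monomials of the symmetric algebra -/

section Symmetric

variable {ι σ : Type*} (k : Type*) [Field k] (v : ι → σ →₀ ℕ)

/-- The monomial `x ^ (v l)` as an element of the ideal generated by all of them. -/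
def generator (l : ι) : Ideal.span (Set.range (mono k v)) :=
  ⟨mono k v l, Ideal.subset_span ⟨l, rfl⟩⟩

/-- The generators of the symmetric algebra of a monomial ideal. -/
def symGenerator (l : ι) :
    SymmetricAlgebra (MvPolynomial σ k) (Ideal.span (Set.range (mono k v))) :=
  SymmetricAlgebra.ι _ _ (generator k v l)

/-- The linear relations of a monomial ideal. -/
theorem monomial_smul_symGenerator {a b : σ →₀ ℕ} {i j : ι} (h : a + v i = b + v j) :
    (monomial a (1 : k)) • symGenerator k v i = (monomial b (1 : k)) • symGenerator k v j := by
  rw [symGenerator, symGenerator, ← map_smul, ← map_smul]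
  congr 1
  ext1
  simp only [generator, mono, Submodule.coe_smul, smul_eq_mul, monomial_mul, h]

variable [Fintype ι]

/-- The element `x ^ a * T ^ α` of the symmetric algebra. -/
def symMonomial (a : σ →₀ ℕ) (α : ι → ℕ) :
    SymmetricAlgebra (MvPolynomial σ k) (Ideal.span (Set.range (mono k v))) :=
  (monomial a (1 : k)) • ∏ l, symGenerator k v l ^ α l

variable {k v}

theorem symMonomial_add_single [DecidableEq ι] (a : σ →₀ ℕ) (α : ι → ℕ) (j : ι) :
    symMonomial k v a (α + Pi.single j 1) = symGenerator k v j * symMonomial k v a α := by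
  simp only [symMonomial, Pi.add_apply, pow_add, Finset.prod_mul_distrib]
  rw [Fintype.prod_eq_single (f := fun l => symGenerator k v l ^ (Pi.single j 1 : ι → ℕ) l) j
    (fun l hl => by rw [Pi.single_eq_of_ne hl, pow_zero]), Pi.single_eq_same, pow_one,
    mul_smul_comm, mul_comm]

theorem symMonomial_exchange [DecidableEq ι] {a b : σ →₀ ℕ} {i j : ι} (h : a + v i = b + v j)
    (α : ι → ℕ) :
    symMonomial k v a (α + Pi.single i 1) = symMonomial k v b (α + Pi.single j 1) := by
  rw [symMonomial_add_single, symMonomial_add_single, symMonomial, symMonomial,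
    mul_smul_comm, mul_smul_comm, ← smul_mul_assoc, ← smul_mul_assoc,
    monomial_smul_symGenerator k v h]

omit [Fintype ι] in
theorem exists_eq_add_single [DecidableEq ι] {α : ι → ℕ} {j : ι} (h : 0 < α j) :
    ∃ α' : ι → ℕ, α = α' + Pi.single j 1 :=
  ⟨α - Pi.single j 1, by
    ext l
    by_cases hl : l = j
    · subst hl
      simp only [Pi.add_apply, Pi.sub_apply, Pi.single_eq_same]
      omega
    · simp [hl]⟩

theorem sum_add_single_smul [DecidableEq ι] {M : Type*} [AddCommMonoid M] (α : ι → ℕ) (j : ι)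
    (f : ι → M) : ∑ l, (α + (Pi.single j 1 : ι → ℕ)) l • f l = ∑ l, α l • f l + f j := by
  simp only [Pi.add_apply, add_smul, Finset.sum_add_distrib]
  congr 1
  rw [Fintype.sum_eq_single j (fun l hl => by rw [Pi.single_eq_of_ne hl, zero_smul]),
    Pi.single_eq_same, one_smul]

theorem coe_symToRees_symMonomial (a : σ →₀ ℕ) (α : ι → ℕ) :
    ((symToRees _ (symMonomial k v a α) : reesAlgebra _) : Polynomial (MvPolynomial σ k)) =
      Polynomial.monomial (∑ l, α l) (monomial (a + ∑ l, α l • v l) 1) := by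
  have h1 : ∀ l, ((symToRees _ (symGenerator k v l) : reesAlgebra _) :
      Polynomial (MvPolynomial σ k)) = Polynomial.monomial 1 (mono k v l) := by
    intro l
    rw [symGenerator, symToRees, SymmetricAlgebra.lift_ι_apply]
    rfl
  rw [symMonomial, map_smul, map_prod, Subalgebra.coe_smul, SubmonoidClass.coe_finsetProd]
  simp only [map_pow, Subalgebra.coe_pow, h1, mono, Polynomial.monomial_pow, monomial_pow, one_pow,
    one_mul]
  have h2 : ∀ s : Finset ι, ∏ l ∈ s, Polynomial.monomial (α l) (monomial (α l • v l) (1 : k)) =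
      Polynomial.monomial (∑ l ∈ s, α l) (monomial (∑ l ∈ s, α l • v l) 1) := by
    classical
    intro s
    induction s using Finset.induction_on with
    | empty => simp
    | insert l s hl ih =>
      rw [Finset.prod_insert hl, ih, Finset.sum_insert hl, Finset.sum_insert hl,
        Polynomial.monomial_mul_monomial, monomial_mul, one_mul]
  rw [h2, Polynomial.smul_monomial, smul_eq_mul, monomial_mul, one_mul]

end Symmetric

/-! ### A linear section over the Rees algebra -/

section Forward

variable {σ : Type*} [Fintype σ] [DecidableEq σ] {k : Type*} [Field k] {v : σ → σ →₀ ℕ}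

/-- Two monomials of the symmetric algebra with the same image in the Rees algebra are equal. -/
theorem symMonomial_eq (hdeg : ∀ l, (v l).degree = 2) (hdet : (logMatrix v).det ≠ 0)
    {a b : σ →₀ ℕ} {α β : σ → ℕ} (h : a + ∑ l, α l • v l = b + ∑ l, β l • v l)
    (hsum : ∑ l, α l = ∑ l, β l) : symMonomial k v a α = symMonomial k v b β := by
  induction hd : ∑ l, α l generalizing a b α β with
  | zero =>
    have h1 : α = 0 := by
      ext l; exact Finset.sum_eq_zero_iff.1 hd l (Finset.mem_univ l)
    have h2 : β = 0 := by
      ext l; exact Finset.sum_eq_zero_iff.1 (hsum.symm.trans hd) l (Finset.mem_univ l)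
    subst h1 h2
    simp only [Pi.zero_apply, zero_smul, Finset.sum_const_zero, add_zero] at h
    rw [h]
  | succ d ih =>
    have hdegree : ∀ (γ : σ → ℕ) j, ∑ l, (γ + (Pi.single j 1 : σ → ℕ)) l = ∑ l, γ l + 1 := by
      intro γ j
      simpa only [smul_eq_mul, mul_one] using sum_add_single_smul γ j fun _ => (1 : ℕ)
    -- Once both sides share a generator, removing it lowers the degree and the induction hypothesis
    -- applies.
    have cancel : ∀ {a b : σ →₀ ℕ} {α β : σ → ℕ} (j : σ),
        a + ∑ l, (α + (Pi.single j 1 : σ → ℕ)) l • v l = b + ∑ l, (β + (Pi.single j 1 : σ → ℕ)) l • v l →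
        ∑ l, α l = d → ∑ l, β l = d →
        symMonomial k v a (α + Pi.single j 1) = symMonomial k v b (β + Pi.single j 1) := by
      intro a b α β j h hα hβ
      rw [sum_add_single_smul, sum_add_single_smul, ← add_assoc, ← add_assoc] at h
      rw [symMonomial_add_single, symMonomial_add_single,
        ih (add_right_cancel h) (hα.trans hβ.symm) hα]
    obtain ⟨e, j, he, hj, hle⟩ := exists_exchange hdeg hdet h (by omega) (by omega)
    obtain ⟨α, rfl⟩ := exists_eq_add_single he
    obtain ⟨β, rfl⟩ := exists_eq_add_single hj
    rw [hdegree] at hd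
    rw [hdegree, hdegree] at hsum
    rcases hle with hle | hle
    -- The linear relation `x^b T_j = x^(b + v_j - v_e) T_e` brings `T_e` to the right-hand side.
    · have hb : b + v j - v e + v e = b + v j := tsub_add_cancel_of_le hle
      rw [← symMonomial_exchange hb]
      refine cancel e ?_ (by omega) (by omega)
      rw [h, sum_add_single_smul, sum_add_single_smul, add_left_comm b, add_left_comm _ _ (v e), hb]
    · have ha : a + v e - v j + v j = a + v e := tsub_add_cancel_of_le hle
      rw [← symMonomial_exchange ha]
      refine cancel j ?_ (by omega) (by omega)
      rw [← h, sum_add_single_smul, sum_add_single_smul, add_left_comm a, add_left_comm _ _ (v j), ha]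

open Classical in
/-- A monomial of the symmetric algebra that is mapped to `x ^ w * t ^ d` in the Rees algebra, if
there is one. -/
def symLift (k : Type*) [Field k] (v : σ → σ →₀ ℕ) (d : ℕ) (w : σ →₀ ℕ) :
    SymmetricAlgebra (MvPolynomial σ k) (Ideal.span (Set.range (mono k v))) :=
  if h : ∃ p : (σ →₀ ℕ) × (σ → ℕ), ∑ l, p.2 l = d ∧ p.1 + ∑ l, p.2 l • v l = w then
    symMonomial k v h.choose.1 h.choose.2 else 0

/-- By `symMonomial_eq` the choice made in `symLift` is immaterial. -/
theorem symLift_eq (hdeg : ∀ l, (v l).degree = 2) (hdet : (logMatrix v).det ≠ 0)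
    (a : σ →₀ ℕ) (α : σ → ℕ) :
    symLift k v (∑ l, α l) (a + ∑ l, α l • v l) = symMonomial k v a α := by
  have h : ∃ p : (σ →₀ ℕ) × (σ → ℕ), ∑ l, p.2 l = ∑ l, α l ∧
      p.1 + ∑ l, p.2 l • v l = a + ∑ l, α l • v l := ⟨(a, α), rfl, rfl⟩
  rw [symLift, dif_pos h]
  exact symMonomial_eq hdeg hdet h.choose_spec.2 h.choose_spec.1

/-- The linear map sending `x ^ w * t ^ d` to a monomial of the symmetric algebra above it. -/
def symSection (k : Type*) [Field k] (v : σ → σ →₀ ℕ) :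
    Polynomial (MvPolynomial σ k) →ₗ[k]
      SymmetricAlgebra (MvPolynomial σ k) (Ideal.span (Set.range (mono k v))) :=
  Polynomial.lsum fun d => (basisMonomials σ k).constr k (symLift k v d)

omit [DecidableEq σ] in
theorem symSection_monomial (d : ℕ) (w : σ →₀ ℕ) :
    symSection k v (Polynomial.monomial d (monomial w 1)) = symLift k v d w := by
  rw [symSection, Polynomial.lsum_apply]
  refine (Polynomial.sum_monomial_index _ _ (by simp)).trans ?_
  exact Module.Basis.constr_basis (basisMonomials σ k) k _ w

end Forward

end LinearType

/-! ### Linear type versus non-vanishing determinant -/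

section Iff

theorem symToRees_surjective {R : Type*} [CommRing R] (I : Ideal R) :
    Function.Surjective (symToRees I) := by
  intro y
  have h : reesAlgebra I ≤ ((reesAlgebra I).val.comp (symToRees I)).range := by
    refine (adjoin_monomial_eq_reesAlgebra I).symm.le.trans (Algebra.adjoin_le ?_)
    rintro _ ⟨a, ha, rfl⟩
    refine ⟨SymmetricAlgebra.ι R I ⟨a, ha⟩, ?_⟩
    exact congrArg Subtype.val (SymmetricAlgebra.lift_ι_apply (toRees I) ⟨a, ha⟩)
  obtain ⟨x, hx⟩ := h y.2
  exact ⟨x, Subtype.ext hx⟩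

theorem aeval_symGenerator_surjective {ι σ k : Type*} [Field k] (v : ι → σ →₀ ℕ) :
    Function.Surjective
      (aeval (R := MvPolynomial σ k) (symGenerator k v)) := by
  intro y
  induction y using SymmetricAlgebra.induction with
  | algebraMap r => exact ⟨C r, aeval_C _ _⟩
  | mul a b ha hb =>
    obtain ⟨p, rfl⟩ := ha
    obtain ⟨q, rfl⟩ := hb
    exact ⟨p * q, map_mul _ _ _⟩
  | add a b ha hb =>
    obtain ⟨p, rfl⟩ := ha
    obtain ⟨q, rfl⟩ := hb
    exact ⟨p + q, map_add _ _ _⟩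
  | ι x =>
    obtain ⟨x, hx⟩ := x
    induction hx using Submodule.span_induction with
    | mem x hx =>
      obtain ⟨l, rfl⟩ := hx
      exact ⟨X l, aeval_X _ _⟩
    | zero => exact ⟨0, by rw [map_zero]; exact (map_zero _).symm⟩
    | add x y hx hy h1 h2 =>
      obtain ⟨p, hp⟩ := h1
      obtain ⟨q, hq⟩ := h2
      refine ⟨p + q, ?_⟩
      rw [map_add, hp, hq, ← map_add]
      rfl
    | smul a x hx h =>
      obtain ⟨p, hp⟩ := h
      refine ⟨a • p, ?_⟩
      rw [map_smul, hp, ← map_smul]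
      rfl

/-- The `k`-linear `symSection` is a left inverse, as checked on the spanning elements `c x^a T^α`.
-/
theorem isOfLinearType_of_det_ne_zero {σ : Type*} [Fintype σ] [DecidableEq σ] {k : Type*}
    [Field k] {v : σ → σ →₀ ℕ} (hdeg : ∀ l, (v l).degree = 2) (hdet : (logMatrix v).det ≠ 0) :
    IsOfLinearType (Ideal.span (Set.range (mono k v))) := by
  refine ⟨?_, symToRees_surjective _⟩
  let Φ : SymmetricAlgebra (MvPolynomial σ k) (Ideal.span (Set.range (mono k v)))
      →ₗ[MvPolynomial σ k] Polynomial (MvPolynomial σ k) :=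
    ((reesAlgebra _).val.comp (symToRees _)).toLinearMap
  have key : ∀ p : MvPolynomial σ (MvPolynomial σ k),
      symSection k v (Φ (aeval (symGenerator k v) p)) = aeval (symGenerator k v) p := by
    intro p
    induction p using induction_on' with
    | add p q hp hq => rw [map_add, map_add, map_add, hp, hq]
    | monomial α r =>
      induction r using induction_on' with
      | add p q hp hq => rw [map_add, map_add, map_add, map_add, hp, hq]
      | monomial a c =>
        have h1 : aeval (symGenerator k v) (monomial α (monomial a c)) =
            c • symMonomial k v a α := by
          rw [aeval_monomial, Finsupp.prod_fintype _ _ (fun _ => pow_zero _), symMonomial,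
            ← smul_assoc, smul_monomial, smul_eq_mul, mul_one, Algebra.smul_def]
        have h2 : Φ (symMonomial k v a α) =
          Polynomial.monomial (∑ l, α l) (monomial (a + ∑ l, α l • v l) 1) :=
          coe_symToRees_symMonomial a α
        rw [h1, LinearMap.map_smul_of_tower, h2, map_smul, symSection_monomial,
          symLift_eq hdeg hdet]
  have hleft : Function.LeftInverse (symSection k v) Φ := by
    intro y
    obtain ⟨p, rfl⟩ := aeval_symGenerator_surjective v y
    exact key p
  exact Function.Injective.of_comp (f := Subtype.val) hleft.injective

/-- Elements of the ideal have no terms of degree below `m`, so in degree `m` only the constant term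
of `r` acts. This makes coefficient extraction linear over the polynomial ring. -/
theorem coeff_mul_of_mem_span {ι σ k : Type*} [Field k] {v : ι → σ →₀ ℕ} {m : ℕ}
    (hdeg : ∀ l, (v l).degree = m) {d : σ →₀ ℕ} (hd : d.degree = m) {f : MvPolynomial σ k}
    (hf : f ∈ Ideal.span (Set.range (mono k v))) (r : MvPolynomial σ k) :
    coeff d (r * f) = constantCoeff r * coeff d f := by
  classical
  induction hf using Submodule.span_induction generalizing r with
  | mem x hx =>
    obtain ⟨l, rfl⟩ := hx
    rw [mono, coeff_mul_monomial', coeff_monomial, mul_one]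
    by_cases h : v l = d
    · simp [h, constantCoeff_eq]
    · rw [if_neg h, mul_zero, if_neg]
      intro hle
      refine h (le_antisymm hle ?_)
      obtain ⟨c, rfl⟩ := exists_add_of_le hle
      rw [map_add, hdeg] at hd
      have : c = 0 := (Finsupp.degree_eq_zero_iff c).1 (by omega)
      simp [this]
  | zero => simp
  | add x y _ _ hx hy => rw [mul_add, coeff_add, coeff_add, hx, hy, mul_add]
  | smul a x _ hx => rw [smul_eq_mul, ← mul_assoc, hx, hx, map_mul, mul_assoc]

/-- Modulo the variables the symmetric algebra maps to `k[T]`, each generator going to its own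
variable; there `T^α = T^β` forces `α = β`. -/
theorem eq_of_sum_smul_eq_of_isOfLinearType {ι σ k : Type*} [Fintype ι] [Field k]
    {v : ι → σ →₀ ℕ} (hinj : Function.Injective v) {m : ℕ} (hdeg : ∀ l, (v l).degree = m)
    (hlin : IsOfLinearType (Ideal.span (Set.range (mono k v)))) {α β : ι → ℕ}
    (h : ∑ l, α l • v l = ∑ l, β l • v l) (hsum : ∑ l, α l = ∑ l, β l) : α = β := by
  classical
  have heq : symMonomial k v 0 α = symMonomial k v 0 β := by
    refine hlin.1 (Subtype.ext ?_)
    rw [coe_symToRees_symMonomial, coe_symToRees_symMonomial, h, hsum]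
  -- The `x` variables act as zero on `k[T]`.
  let _ : Algebra (MvPolynomial σ k) (MvPolynomial ι k) :=
    ((C : k →+* MvPolynomial ι k).comp constantCoeff).toAlgebra
  have hsmul : ∀ (r : MvPolynomial σ k) (q : MvPolynomial ι k),
      r • q = C (constantCoeff r) * q := fun r q => rfl
  let L : Ideal.span (Set.range (mono k v)) →ₗ[MvPolynomial σ k] MvPolynomial ι k :=
    { toFun := fun f => ∑ l, C (coeff (v l) (f : MvPolynomial σ k)) * X l
      map_add' := fun f g => by
        simp only [Submodule.coe_add, coeff_add, map_add, add_mul, Finset.sum_add_distrib]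
      map_smul' := fun r f => by
        simp only [Submodule.coe_smul, smul_eq_mul, RingHom.id_apply, hsmul, Finset.mul_sum]
        refine Finset.sum_congr rfl fun l _ => ?_
        rw [coeff_mul_of_mem_span hdeg (hdeg l) f.2, map_mul, mul_assoc] }
  have hL : ∀ l, SymmetricAlgebra.lift L (symGenerator k v l) = X l := by
    intro l
    rw [symGenerator, SymmetricAlgebra.lift_ι_apply]
    change ∑ j, C (coeff (v j) (monomial (v l) (1 : k))) * X j = X l
    simp [coeff_monomial, hinj.eq_iff]
  have himage : ∀ γ : ι → ℕ, SymmetricAlgebra.lift L (symMonomial k v 0 γ) =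
      monomial (Finsupp.equivFunOnFinite.symm γ) 1 := by
    intro γ
    have h1 : monomial (Finsupp.equivFunOnFinite.symm γ) (1 : k) = ∏ l, X l ^ γ l := by
      rw [monomial_eq, C_1, one_mul, Finsupp.prod_fintype _ _ (fun _ => pow_zero _)]
      rfl
    rw [symMonomial, map_smul, map_prod, h1, hsmul]
    simp [hL]
  have h1 := congrArg (SymmetricAlgebra.lift L) heq
  rw [himage, himage] at h1
  exact Finsupp.equivFunOnFinite.symm.injective
    (monomial_left_injective (one_ne_zero (α := k)) h1)

theorem det_ne_zero_of_isOfLinearType {σ : Type*} [Fintype σ] [DecidableEq σ] {k : Type*}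
    [Field k] {v : σ → σ →₀ ℕ} (hinj : Function.Injective v) (hdeg : ∀ l, (v l).degree = 2)
    (hlin : IsOfLinearType (Ideal.span (Set.range (mono k v)))) : (logMatrix v).det ≠ 0 := by
  intro hdet
  obtain ⟨α, β, hne, heq, hsum⟩ := exists_sum_smul_eq_of_det_eq_zero hdeg hdet
  exact hne (eq_of_sum_smul_eq_of_isOfLinearType hinj hdeg hlin heq hsum)

/-- For an empty set of monomials, `0` would be a common factor. -/
theorem nonempty_of_isCohesive {ι σ k : Type*} [Field k] {v : ι → σ →₀ ℕ}
    (h : IsCohesive (Set.range (mono k v))) : Nonempty ι := by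
  by_contra hne
  rw [not_nonempty_iff] at hne
  exact not_isUnit_zero (h.1 0 (by rintro _ ⟨l, -⟩; exact hne.elim l))

end Iff

end MonomialCremona

end

theorem proposition5 {k : Type*} [Field k] (n : ℕ) (v : Fin n → Fin n →₀ ℕ)
    (hinj : Function.Injective v)
    (hdeg : ∀ l, (v l).degree = 2)
    (hcoh : MonomialCremona.IsCohesive (Set.range (MonomialCremona.mono k v))) :
    List.TFAE [
      (MonomialCremona.logMatrix v).det ≠ 0,
      MonomialCremona.DefinesCremona (MonomialCremona.mono k v),
      (MonomialCremona.loops v = ∅ ∧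
          MonomialCremona.HasUniqueCycleOdd (MonomialCremona.simpleGraph v)) ∨
        ((MonomialCremona.simpleGraph v).IsTree ∧ ∃! i, i ∈ MonomialCremona.loops v),
      MonomialCremona.IsOfLinearType (Ideal.span (Set.range (MonomialCremona.mono k v)))] := by
  have hne : Nonempty (Fin n) := MonomialCremona.nonempty_of_isCohesive hcoh
  have h13 : (MonomialCremona.logMatrix v).det ≠ 0 → _ := fun hdet =>
    MonomialCremona.isTree_or_hasUniqueCycleOdd_of_det_ne_zero hinj hdeg
      (MonomialCremona.connected_of_det_ne_zero hdeg hcoh.2 hdet) hdet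
  tfae_have 1 → 3 := h13
  tfae_have 3 → 1 := fun h =>
    have h' := MonomialCremona.connected_and_exists_mulVec_eq_two hinj hdeg h
    MonomialCremona.det_ne_zero_of_connected h'.1 h'.2
  tfae_have 1 → 2 := fun hdet =>
    have h' := MonomialCremona.connected_and_exists_mulVec_eq_two hinj hdeg (h13 hdet)
    MonomialCremona.definesCremona_of_mulVec hdeg hdet
      (MonomialCremona.exists_mulVec_eq_single_sub_single h'.1 h'.2)
  tfae_have 2 → 1 := fun ⟨_, _, _, _, h⟩ => MonomialCremona.det_ne_zero_of_compIsId hdeg h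
  tfae_have 1 → 4 := MonomialCremona.isOfLinearType_of_det_ne_zero hdeg
  tfae_have 4 → 1 := MonomialCremona.det_ne_zero_of_isOfLinearType hinj hdeg
  tfae_finish
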